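/- Let $d\ge 1$, let $\Omega\subset\mathbb{R}^d$ be open and bounded, and let $A\subset\mathbb{R}^d$ be a set with $C^1$ boundary in a neighborhood of $\overline\Omega$. That is, there is an open set $U\supset\overline\Omega$ such that every $p\in\partial A\cap U$ has an open neighborhood $V$ and a $C^1$ function $\varphi:V\to\mathbb{R}$ with $\nabla\varphi\neq 0$ on $V$, $\partial A\cap V=\{\varphi=0\}$ and $\{\varphi<0\}\subset A\cap V\subset\{\varphi\le 0\}$ (so $\partial A$ is a $C^1$ hypersurface and $A$ lies locally on one side of it). Suppose further that $\mathcal{H}^{d-1}(\partial A\cap\partial\Omega)=0$. Then for every (arbitrary) set $M\subset\Omega$, $$\limsup_{r\downarrow 0}\ \mathcal{H}^{d-1}\Big(\big(\{x:\operatorname{dist}(x,A)=r\}\cap\Omega\big)\setminus\{x:\operatorname{dist}(x,M)<3r\}\Big)\ \le\ \mathcal{H}^{d-1}\big((\partial A\cap\Omega)\setminus M\big),$$ where $\mathcal{H}^{d-1}$ is the $(d-1)$-dimensional Hausdorff (outer) measure and $\operatorname{dist}(x,\emptyset)=+\infty$. -/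

import Mathlib

/-- The set `A` has `C¹` boundary in the set `U`: near each point of `∂A ∩ U`, the boundary `∂A` is
the regular zero set `{φ = 0}` of a real `C¹` function `φ` (i.e. an embedded `C¹` hypersurface
without boundary), and `A` lies locally on exactly one side of it, namely
`{φ < 0} ⊆ A ⊆ {φ ≤ 0}` in the neighbourhood `V`. -/
def HasC1BoundaryIn {d : ℕ} (A U : Set (EuclideanSpace ℝ (Fin d))) : Prop :=
  ∀ p ∈ frontier A ∩ U, ∃ (V : Set (EuclideanSpace ℝ (Fin d))) (φ : EuclideanSpace ℝ (Fin d) → ℝ),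
    IsOpen V ∧ p ∈ V ∧ ContDiffOn ℝ 1 φ V ∧ (∀ x ∈ V, fderiv ℝ φ x ≠ 0) ∧
    (∀ x ∈ V, x ∈ frontier A ↔ φ x = 0) ∧
    (∀ x ∈ V, φ x < 0 → x ∈ A) ∧ (∀ x ∈ V, 0 < φ x → x ∉ A)

open MeasureTheory Set Metric Filter Topology
open scoped InnerProductSpace ENNReal NNReal

/-! Near a boundary point with unit normal `n`, `∂A` is a nearly flat graph over `nᗮ`. The level set
`{dist = r}` is equally flat there (`inner_le_of_infEDist_eq`), so projection to `nᗮ` is injective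
on it with a `K`-Lipschitz inverse, `K` close to 1. Its shadow lies in that of `∂A`, since moving
down by at most `2r` along `n` meets `∂A`. As projection is 1-Lipschitz, the level set over a cell
`C` has measure at most `K ^ (d - 1)` times that of `∂A` within `2r` of `C`
(`hausdorffMeasure_level_le`). Finitely many disjoint cells cover `∂A ∩ closure Ω`. As `r → 0` the
thickenings shrink to closed cells, which overlap in an `H^{d-1}`-null part of `∂A`: the bounding
spheres are chosen null, and `∂A ∩ ∂Ω` is null by hypothesis. Finally `K → 1`. -/

/-- A point at distance `r` from `A` has a nearest point in the closure of `A`. -/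
theorem exists_mem_closure_dist_eq {X : Type*} [PseudoMetricSpace X] [ProperSpace X] {A : Set X}
    {x : X} {r : ℝ} (hr : 0 ≤ r) (hx : infEDist x A = ENNReal.ofReal r) :
    ∃ a ∈ closure A, dist x a = r := by
  have hne : A.Nonempty := by
    rw [nonempty_iff_ne_empty]
    rintro rfl
    simp at hx
  obtain ⟨a, ha, hxa⟩ := exists_mem_closure_infDist_eq_dist hne x
  exact ⟨a, ha, by rw [← hxa, infDist, hx, ENNReal.toReal_ofReal hr]⟩

theorem notMem_closure_of_infEDist_eq {X : Type*} [PseudoMetricSpace X] {A : Set X} {x : X} {r : ℝ}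
    (hr : 0 < r) (hx : infEDist x A = ENNReal.ofReal r) : x ∉ closure A := by
  rw [mem_closure_iff_infEDist_zero, hx]
  simpa using hr

/-! ### Flatness of the boundary and of nearby distance level sets -/

section GraphChart

variable {E : Type*} [NormedAddCommGroup E] [InnerProductSpace ℝ E]

/-- On the ball of radius `ρ` around `p`, the set `A` is given, up to boundary points, by `ψ ≤ 0`,
where `ψ` is `ε`-close in the Lipschitz sense to the linear form of the unit vector `n`. -/
structure IsGraphChart (A : Set E) (ε ρ : ℝ) (p n : E) (ψ : E → ℝ) : Prop where
  norm_eq : ‖n‖ = 1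
  continuousOn : ContinuousOn ψ (ball p ρ)
  approx : ∀ x ∈ ball p ρ, ∀ y ∈ ball p ρ, |ψ x - ψ y - ⟪n, x - y⟫_ℝ| ≤ ε * ‖x - y‖
  frontier_iff : ∀ x ∈ ball p ρ, x ∈ frontier A ↔ ψ x = 0
  mem_of_neg : ∀ x ∈ ball p ρ, ψ x < 0 → x ∈ A
  notMem_of_pos : ∀ x ∈ ball p ρ, 0 < ψ x → x ∉ A

/-- A `C¹` defining function with nonzero gradient gives graph charts of arbitrary precision. -/
theorem exists_isGraphChart [CompleteSpace E] {A V : Set E} {p : E} {φ : E → ℝ} (hV : IsOpen V)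
    (hp : p ∈ V) (hφ : ContDiffOn ℝ 1 φ V) (hφ' : fderiv ℝ φ p ≠ 0)
    (hfr : ∀ x ∈ V, x ∈ frontier A ↔ φ x = 0) (hneg : ∀ x ∈ V, φ x < 0 → x ∈ A)
    (hpos : ∀ x ∈ V, 0 < φ x → x ∉ A) {ε : ℝ} (hε : 0 < ε) :
    ∃ ρ > 0, ∃ (n : E) (ψ : E → ℝ), IsGraphChart A ε ρ p n ψ := by
  set g : E := (InnerProductSpace.toDual ℝ E).symm (fderiv ℝ φ p) with hg
  have hg0 : 0 < ‖g‖ := by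
    rw [norm_pos_iff, hg]
    simpa using hφ'
  have hgi : ∀ v, fderiv ℝ φ p v = ⟪g, v⟫_ℝ := fun v => by
    rw [hg, InnerProductSpace.toDual_symm_apply]
  have hstrict : HasStrictFDerivAt φ (fderiv ℝ φ p) p :=
    (hφ.contDiffAt (hV.mem_nhds hp)).hasStrictFDerivAt one_ne_zero
  -- Strict differentiability compares two moving points; the precision `ε * ‖g‖` becomes `ε` once
  -- `φ` is divided by `‖g‖`.
  have hev := hstrict.isLittleO.def (mul_pos hε hg0)
  rw [nhds_prod_eq] at hev
  obtain ⟨t, ht, hbd⟩ := mem_prod_self_iff.1 hev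
  obtain ⟨ρ, hρ, hsub⟩ := Metric.mem_nhds_iff.1 (inter_mem ht (hV.mem_nhds hp))
  have hVs : ∀ x ∈ ball p ρ, x ∈ V := fun x hx => (hsub hx).2
  refine ⟨ρ, hρ, ‖g‖⁻¹ • g, fun x => ‖g‖⁻¹ * φ x, ?_, ?_, ?_, ?_, ?_, ?_⟩
  · rw [norm_smul, norm_inv, norm_norm, inv_mul_cancel₀ hg0.ne']
  · exact continuousOn_const.mul (hφ.continuousOn.mono hVs)
  · intro x hx y hy
    have h := hbd (mk_mem_prod (hsub hx).1 (hsub hy).1)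
    simp only [mem_ofPred_eq, Real.norm_eq_abs, hgi] at h
    rw [real_inner_smul_left, ← mul_sub, ← mul_sub, abs_mul, abs_of_pos (inv_pos.2 hg0),
      inv_mul_le_iff₀ hg0]
    linarith
  · intro x hx
    rw [hfr x (hVs x hx)]
    simp [hg0.ne']
  · intro x hx h
    exact hneg x (hVs x hx) (by simpa [inv_pos.2 hg0, mul_neg_iff, hg0.le.not_gt] using h)
  · intro x hx h
    exact hpos x (hVs x hx) (pos_of_mul_pos_right h (inv_pos.2 hg0).le)

namespace IsGraphChart

variable {A : Set E} {ε ρ : ℝ} {p n : E} {ψ : E → ℝ}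

theorem nonpos_of_mem_closure (h : IsGraphChart A ε ρ p n ψ) {x : E} (hx : x ∈ ball p ρ)
    (hxA : x ∈ closure A) : ψ x ≤ 0 := by
  by_contra! hpos
  have hmem : ∀ᶠ y in 𝓝 x, 0 < ψ y ∧ y ∈ ball p ρ :=
    ((h.continuousOn.continuousAt (isOpen_ball.mem_nhds hx)).eventually (lt_mem_nhds hpos)).and
      (isOpen_ball.mem_nhds hx)
  obtain ⟨y, hyA, hy⟩ := (mem_closure_iff_frequently.1 hxA).and_eventually hmem |>.exists
  exact h.notMem_of_pos y hy.2 hy.1 hyA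

theorem pos_of_notMem_closure (h : IsGraphChart A ε ρ p n ψ) {x : E} (hx : x ∈ ball p ρ)
    (hxA : x ∉ closure A) : 0 < ψ x := by
  by_contra! hle
  rcases hle.lt_or_eq with hlt | heq
  · exact hxA (subset_closure (h.mem_of_neg x hx hlt))
  · exact hxA (frontier_subset_closure ((h.frontier_iff x hx).2 heq))

theorem abs_inner_le_of_mem_frontier (h : IsGraphChart A ε ρ p n ψ) {x y : E}
    (hx : x ∈ ball p ρ) (hy : y ∈ ball p ρ) (hxA : x ∈ frontier A) (hyA : y ∈ frontier A) :
    |⟪n, x - y⟫_ℝ| ≤ ε * ‖x - y‖ := by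
  have := h.approx x hx y hy
  rwa [(h.frontier_iff x hx).1 hxA, (h.frontier_iff y hy).1 hyA, sub_zero, zero_sub,
    abs_neg] at this

/-- If `x` were too high above `y`, translating a nearest point of `x` by `y - x` would give a point
interior to `A` at distance exactly `r` from `y`; moving from it slightly towards `y` would
contradict `dist(y, A) = r`. -/
theorem inner_le_of_infEDist_eq [ProperSpace E] (h : IsGraphChart A ε ρ p n ψ) {r : ℝ}
    (hr : 0 < r) (hrρ : r < ρ / 8) {x y : E} (hx : x ∈ ball p (ρ / 4)) (hy : y ∈ ball p (ρ / 4))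
    (hxA : infEDist x A = ENNReal.ofReal r) (hyA : infEDist y A = ENNReal.ofReal r) :
    ⟪n, x - y⟫_ℝ ≤ ε * ‖x - y‖ := by
  by_contra! hlt
  obtain ⟨a, ha, hxa⟩ := exists_mem_closure_dist_eq hr.le hxA
  rw [mem_ball] at hx hy
  have haB : a ∈ ball p ρ := by
    rw [mem_ball]
    have := dist_triangle_left a p x
    linarith
  set b : E := a + (y - x) with hb
  have hyb : dist y b = r := by
    rw [← hxa, dist_eq_norm, dist_eq_norm, hb]
    congr 1
    abel
  have hbB : b ∈ ball p ρ := by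
    rw [mem_ball]
    have := dist_triangle_left b p y
    linarith
  have hψb : ψ b < 0 := by
    have h1 := (abs_le.1 (h.approx b hbB a haB)).2
    have h2 : b - a = -(x - y) := by rw [hb]; abel
    rw [h2, inner_neg_right, norm_neg] at h1
    linarith [h.nonpos_of_mem_closure haB ha]
  -- a neighbourhood of `b` lies in `A`, so that `y` is closer to `A` than `r`
  have hev : ∀ᶠ z in 𝓝 b, z ∈ A := by
    filter_upwards [(h.continuousOn.continuousAt (isOpen_ball.mem_nhds hbB)).eventually
      (gt_mem_nhds hψb), isOpen_ball.mem_nhds hbB] with z hz hzB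
    exact h.mem_of_neg z hzB hz
  have hcont : Tendsto (fun t : ℝ => b + t • (y - b)) (𝓝[>] 0) (𝓝 b) := by
    have : Tendsto (fun t : ℝ => b + t • (y - b)) (𝓝 0) (𝓝 (b + (0 : ℝ) • (y - b))) :=
      Continuous.tendsto (by fun_prop) 0
    rw [zero_smul, add_zero] at this
    exact this.mono_left nhdsWithin_le_nhds
  obtain ⟨t, htA, ht⟩ := ((hcont.eventually hev).and
    (Ioo_mem_nhdsGT (show (0 : ℝ) < 1 by norm_num))).exists
  have hdist : dist y (b + t • (y - b)) = (1 - t) * r := by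
    rw [← hyb, dist_eq_norm, dist_eq_norm]
    have : y - (b + t • (y - b)) = (1 - t) • (y - b) := by
      rw [sub_smul, one_smul]; abel
    rw [this, norm_smul, Real.norm_eq_abs, abs_of_pos (by linarith [ht.2])]
  have hle := infEDist_le_edist_of_mem (x := y) htA
  rw [hyA, edist_dist, hdist, ENNReal.ofReal_le_ofReal_iff
    (mul_nonneg (by linarith [ht.2]) hr.le)] at hle
  nlinarith [ht.1]

theorem abs_inner_le_of_infEDist_eq [ProperSpace E] (h : IsGraphChart A ε ρ p n ψ) {r : ℝ}
    (hr : 0 < r) (hrρ : r < ρ / 8) {x y : E} (hx : x ∈ ball p (ρ / 4)) (hy : y ∈ ball p (ρ / 4))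
    (hxA : infEDist x A = ENNReal.ofReal r) (hyA : infEDist y A = ENNReal.ofReal r) :
    |⟪n, x - y⟫_ℝ| ≤ ε * ‖x - y‖ := by
  refine abs_le'.2 ⟨h.inner_le_of_infEDist_eq hr hrρ hx hy hxA hyA, ?_⟩
  have := h.inner_le_of_infEDist_eq hr hrρ hy hx hyA hxA
  rwa [← neg_sub x y, inner_neg_right, norm_neg] at this

/-- Below each point at distance `r` from `A` there is a boundary point at distance `≤ 2 r`. -/
theorem exists_smul_sub_mem_frontier [ProperSpace E] (h : IsGraphChart A ε ρ p n ψ)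
    (hε : ε ≤ 1 / 3) {r : ℝ} (hr : 0 < r) (hrρ : r < ρ / 8) {x : E} (hx : x ∈ ball p (ρ / 4))
    (hxA : infEDist x A = ENNReal.ofReal r) :
    ∃ t ∈ Icc 0 (2 * r), x - t • n ∈ frontier A ∩ ball p ρ := by
  obtain ⟨a, ha, hxa⟩ := exists_mem_closure_dist_eq hr.le hxA
  rw [mem_ball] at hx
  have hxB : x ∈ ball p ρ := by rw [mem_ball]; linarith
  have haB : a ∈ ball p ρ := by
    rw [mem_ball]
    have := dist_triangle_left a p x
    linarith
  have hline : ∀ t ∈ Icc 0 (2 * r), x - t • n ∈ ball p ρ := by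
    intro t ht
    have h1 : dist (x - t • n) x = t := by
      rw [dist_eq_norm, sub_sub_cancel_left, norm_neg, norm_smul, h.norm_eq, mul_one,
        Real.norm_eq_abs, abs_of_nonneg ht.1]
    rw [mem_ball]
    have := dist_triangle (x - t • n) x p
    linarith [ht.2]
  have hψx : ψ x ≤ (1 + ε) * r := by
    have h1 := (abs_le.1 (h.approx x hxB a haB)).2
    have h2 := real_inner_le_norm n (x - a)
    rw [h.norm_eq, one_mul] at h2
    rw [← dist_eq_norm, hxa] at h1 h2
    linarith [h.nonpos_of_mem_closure haB ha]
  -- Descending by `2r` lowers `ψ` by at least `2(1 - ε)r`, which beats `(1 + ε)r` exactly when `ε ≤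
  -- 1/3`.
  have hend : ψ (x - (2 * r) • n) ≤ 0 := by
    have h1 := (abs_le.1 (h.approx _ (hline (2 * r) ⟨by linarith, le_rfl⟩) x hxB)).2
    rw [sub_sub_cancel_left, inner_neg_right, norm_neg, norm_smul, real_inner_smul_right,
      real_inner_self_eq_norm_sq, h.norm_eq, Real.norm_eq_abs, abs_of_pos (by linarith)] at h1
    nlinarith
  have hstart : 0 < ψ (x - (0 : ℝ) • n) := by
    rw [zero_smul, sub_zero]
    exact h.pos_of_notMem_closure hxB (notMem_closure_of_infEDist_eq hr hxA)
  have hc : ContinuousOn (fun t : ℝ => ψ (x - t • n)) (Icc 0 (2 * r)) :=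
    h.continuousOn.comp (Continuous.continuousOn (by fun_prop)) hline
  obtain ⟨t, ht, htψ⟩ := intermediate_value_Icc' (by linarith) hc ⟨hend, hstart.le⟩
  exact ⟨t, ht, (h.frontier_iff _ (hline t ht)).2 htψ, hline t ht⟩

end IsGraphChart

/-- A vector that is almost orthogonal to `n` is controlled by its projection to `nᗮ`. -/
theorem norm_le_mul_norm_orthogonalProjectionOnto {n v : E} (hn : ‖n‖ = 1) {ε K : ℝ}
    (hK0 : 0 ≤ K) (hK : 1 ≤ K ^ 2 * (1 - ε ^ 2))
    (hv : |⟪n, v⟫_ℝ| ≤ ε * ‖v‖) : ‖v‖ ≤ K * ‖(ℝ ∙ n)ᗮ.orthogonalProjectionOnto v‖ := by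
  have h1 := Submodule.norm_sq_eq_add_norm_sq_projection v (ℝ ∙ n)
  have h2 : ‖(ℝ ∙ n).orthogonalProjectionOnto v‖ = |⟪n, v⟫_ℝ| := by
    have := Submodule.starProjection_unit_singleton ℝ hn v
    rw [← Submodule.norm_coe]
    change ‖(ℝ ∙ n).starProjection v‖ = _
    rw [this, norm_smul, hn, mul_one, Real.norm_eq_abs]
  rw [h2] at h1
  -- By Pythagoras, `(1 - ε²)‖v‖²` is at most the squared norm of the projection; `hK` then gives
  -- the factor `K`.
  have h3 : |⟪n, v⟫_ℝ| ^ 2 ≤ (ε * ‖v‖) ^ 2 := pow_le_pow_left₀ (abs_nonneg _) hv 2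
  refine le_of_sq_le_sq ?_ (by positivity)
  nlinarith [sq_nonneg ‖v‖, sq_nonneg K]

end GraphChart

/-! ### Hausdorff measure through projection to the tangent hyperplane -/

/-- The Hausdorff measure of a set on which `f` is antilipschitz is controlled by its image. -/
theorem hausdorffMeasure_le_of_antilipschitzOn {X Y : Type*} [MetricSpace X] [MetricSpace Y]
    [MeasurableSpace X] [BorelSpace X] [MeasurableSpace Y] [BorelSpace Y] {f : X → Y} {s : Set X}
    {K : ℝ≥0} (hf : ∀ x ∈ s, ∀ y ∈ s, dist x y ≤ K * dist (f x) (f y)) {q : ℝ} (hq : 0 ≤ q) :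
    Measure.hausdorffMeasure q s ≤ (K : ℝ≥0∞) ^ q * Measure.hausdorffMeasure q (f '' s) := by
  rcases s.eq_empty_or_nonempty with rfl | ⟨x₀, -⟩
  · simp
  have : Nonempty X := ⟨x₀⟩
  have hinj : InjOn f s := fun x hx y hy hxy => by
    have := hf x hx y hy
    rw [hxy, dist_self, mul_zero] at this
    exact dist_le_zero.1 this
  have hinv : LeftInvOn (Function.invFunOn f s) f s := hinj.leftInvOn_invFunOn
  have hlip : LipschitzOnWith K (Function.invFunOn f s) (f '' s) := by
    refine LipschitzOnWith.of_dist_le_mul ?_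
    rintro _ ⟨x, hx, rfl⟩ _ ⟨y, hy, rfl⟩
    rw [hinv hx, hinv hy]
    exact hf x hx y hy
  have := hlip.hausdorffMeasure_image_le hq
  rwa [hinv.image_image] at this

theorem hausdorffMeasure_orthogonal_ball_lt_top {d : ℕ} (hd : 1 ≤ d)
    {n : EuclideanSpace ℝ (Fin d)} (hn : n ≠ 0) (q : (ℝ ∙ n)ᗮ) (ρ : ℝ) :
    Measure.hausdorffMeasure ((d : ℝ) - 1) (ball q ρ) < ∞ := by
  have : Fact (Module.finrank ℝ (EuclideanSpace ℝ (Fin d)) = (d - 1) + 1) :=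
    ⟨by rw [finrank_euclideanSpace_fin]; omega⟩
  have hrank : ((Module.finrank ℝ (ℝ ∙ n)ᗮ : ℕ) : ℝ) = (d : ℝ) - 1 := by
    rw [Submodule.finrank_orthogonal_span_singleton (n := d - 1) hn, Nat.cast_sub hd, Nat.cast_one]
  have := isAddHaarMeasure_hausdorffMeasure (E := (ℝ ∙ n)ᗮ)
  rw [hrank] at this
  exact measure_ball_lt_top

section Euclidean

variable {d : ℕ}

namespace IsGraphChart

variable {A : Set (EuclideanSpace ℝ (Fin d))} {ε ρ : ℝ} {p n : EuclideanSpace ℝ (Fin d)}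
  {ψ : EuclideanSpace ℝ (Fin d) → ℝ}

/-- Local finiteness serves twice: to find spheres that are null in `∂A`, and to pass to the limit
along shrinking thickenings. -/
theorem hausdorffMeasure_frontier_lt_top (h : IsGraphChart A ε ρ p n ψ) (hd : 1 ≤ d) {K : ℝ≥0}
    (hK : 1 ≤ (K : ℝ) ^ 2 * (1 - ε ^ 2)) :
    Measure.hausdorffMeasure ((d : ℝ) - 1) (frontier A ∩ ball p ρ) < ∞ := by
  have hd' : (0 : ℝ) ≤ (d : ℝ) - 1 := by
    rw [sub_nonneg]
    exact_mod_cast hd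
  have hn : n ≠ 0 := norm_pos_iff.1 (by rw [h.norm_eq]; exact one_pos)
  refine (hausdorffMeasure_le_of_antilipschitzOn (f := (ℝ ∙ n)ᗮ.orthogonalProjectionOnto) (K := K)
    ?_ hd').trans_lt ?_
  · intro x hx y hy
    rw [dist_eq_norm, dist_eq_norm, ← map_sub]
    exact norm_le_mul_norm_orthogonalProjectionOnto h.norm_eq K.2 hK
      (h.abs_inner_le_of_mem_frontier hx.2 hy.2 hx.1 hy.1)
  · refine ENNReal.mul_lt_top (ENNReal.rpow_lt_top_of_nonneg hd' ENNReal.coe_ne_top)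
      ((measure_mono ?_).trans_lt (hausdorffMeasure_orthogonal_ball_lt_top hd hn
        ((ℝ ∙ n)ᗮ.orthogonalProjectionOnto p) ρ))
    rintro _ ⟨x, hx, rfl⟩
    have := (Submodule.lipschitzWith_orthogonalProjectionOnto (ℝ ∙ n)ᗮ).dist_le_mul x p
    rw [NNReal.coe_one, one_mul] at this
    exact this.trans_lt hx.2

/-- The part of a level set of the distance to `A` over a set `C` is controlled by the part of the
boundary of `A` near `C`. -/
theorem hausdorffMeasure_level_le (h : IsGraphChart A ε ρ p n ψ) (hd : 1 ≤ d) {K : ℝ≥0}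
    (hε : ε ≤ 1 / 3) (hK : 1 ≤ (K : ℝ) ^ 2 * (1 - ε ^ 2)) {r : ℝ} (hr : 0 < r) (hrρ : r < ρ / 8)
    {C : Set (EuclideanSpace ℝ (Fin d))} (hC : C ⊆ ball p (ρ / 4))
    (M : Set (EuclideanSpace ℝ (Fin d))) :
    Measure.hausdorffMeasure ((d : ℝ) - 1)
        (({x | infEDist x A = ENNReal.ofReal r} ∩ C) \
          {x | infEDist x M < ENNReal.ofReal (3 * r)}) ≤
      (K : ℝ≥0∞) ^ ((d : ℝ) - 1) * Measure.hausdorffMeasure ((d : ℝ) - 1)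
        (cthickening (2 * r) C ∩ ((frontier A ∩ ball p ρ) \ closure M)) := by
  have hd' : (0 : ℝ) ≤ (d : ℝ) - 1 := by
    rw [sub_nonneg]
    exact_mod_cast hd
  set P := (ℝ ∙ n)ᗮ.orthogonalProjectionOnto with hP
  refine (hausdorffMeasure_le_of_antilipschitzOn (f := P) (K := K) ?_ hd').trans ?_
  · intro x hx y hy
    rw [dist_eq_norm, dist_eq_norm, ← map_sub]
    exact norm_le_mul_norm_orthogonalProjectionOnto h.norm_eq K.2 hK
      (h.abs_inner_le_of_infEDist_eq hr hrρ (hC hx.1.2) (hC hy.1.2) hx.1.1 hy.1.1)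
  gcongr
  have hlip := (Submodule.lipschitzWith_orthogonalProjectionOnto (ℝ ∙ n)ᗮ).hausdorffMeasure_image_le
    hd' (cthickening (2 * r) C ∩ ((frontier A ∩ ball p ρ) \ closure M))
  rw [ENNReal.coe_one, ENNReal.one_rpow, one_mul] at hlip
  refine (measure_mono ?_).trans hlip
  rintro _ ⟨x, ⟨⟨hxA, hxC⟩, hxM⟩, rfl⟩
  obtain ⟨t, ht, hfr⟩ := h.exists_smul_sub_mem_frontier hε hr hrρ (hC hxC) hxA
  have hdist : dist (x - t • n) x ≤ 2 * r := by
    rw [dist_eq_norm, sub_sub_cancel_left, norm_neg, norm_smul, h.norm_eq, mul_one,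
      Real.norm_eq_abs, abs_of_nonneg ht.1]
    exact ht.2
  -- The point moved by at most `2r`, so distance at least `3r` from `M` keeps it off `closure M`.
  refine ⟨x - t • n, ⟨mem_cthickening_of_dist_le _ x _ _ hxC hdist, hfr, fun hcl => hxM ?_⟩, ?_⟩
  · rw [mem_closure_iff_infEDist_zero] at hcl
    have h1 := infEDist_le_infEDist_add_edist (x := x) (y := x - t • n) (s := M)
    rw [hcl, zero_add, edist_dist, dist_comm] at h1
    exact h1.trans_lt ((ENNReal.ofReal_lt_ofReal_iff (by linarith)).2 (by linarith))
  · rw [map_sub, Submodule.orthogonalProjectionOnto_orthogonal_apply_eq_zero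
      (Submodule.smul_mem _ _ (Submodule.mem_span_singleton_self n)), sub_zero]

end IsGraphChart

/-- Local form of the estimate: near a boundary point, level sets of the distance are controlled by
the boundary up to a factor arbitrarily close to one. -/
theorem HasC1BoundaryIn.exists_radius {A U : Set (EuclideanSpace ℝ (Fin d))}
    (hA : HasC1BoundaryIn A U) (hd : 1 ≤ d) (M : Set (EuclideanSpace ℝ (Fin d))) {K : ℝ≥0}
    (hK : 1 < K) {p : EuclideanSpace ℝ (Fin d)} (hp : p ∈ frontier A ∩ U) :
    ∃ ρ > 0, Measure.hausdorffMeasure ((d : ℝ) - 1) (frontier A ∩ ball p ρ) < ∞ ∧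
      ∀ r, 0 < r → r < ρ / 8 → ∀ C ⊆ ball p (ρ / 4), Measure.hausdorffMeasure ((d : ℝ) - 1)
        (({x | infEDist x A = ENNReal.ofReal r} ∩ C) \
          {x | infEDist x M < ENNReal.ofReal (3 * r)}) ≤
      (K : ℝ≥0∞) ^ ((d : ℝ) - 1) * Measure.hausdorffMeasure ((d : ℝ) - 1)
        (cthickening (2 * r) C ∩ ((frontier A ∩ ball p ρ) \ closure M)) := by
  have hK' : (1 : ℝ) < K := by exact_mod_cast hK
  obtain ⟨ε, hε, hε3, hKε⟩ : ∃ ε : ℝ, 0 < ε ∧ ε ≤ 1 / 3 ∧ 1 ≤ (K : ℝ) ^ 2 * (1 - ε ^ 2) := by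
    have h1 : ∀ᶠ ε : ℝ in 𝓝[>] 0, 1 < (K : ℝ) ^ 2 * (1 - ε ^ 2) := by
      have h2 : Tendsto (fun ε : ℝ => (K : ℝ) ^ 2 * (1 - ε ^ 2)) (𝓝 0)
          (𝓝 ((K : ℝ) ^ 2 * (1 - 0 ^ 2))) := Continuous.tendsto (by fun_prop) 0
      exact (h2.mono_left nhdsWithin_le_nhds).eventually (lt_mem_nhds (by nlinarith))
    obtain ⟨ε, h3, h4⟩ := (h1.and (Ioo_mem_nhdsGT (show (0 : ℝ) < 1 / 3 by norm_num))).exists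
    exact ⟨ε, h4.1, h4.2.le, h3.le⟩
  obtain ⟨V, φ, hV, hpV, hφ, hφ', hfr, hneg, hpos⟩ := hA p hp
  obtain ⟨ρ, hρ, n, ψ, h⟩ := exists_isGraphChart hV hpV hφ (hφ' p hpV) hfr hneg hpos hε
  exact ⟨ρ, hρ, h.hausdorffMeasure_frontier_lt_top hd hKε, fun r hr hrρ C hC =>
    h.hausdorffMeasure_level_le hd hε3 hKε hr hrρ hC M⟩

/-! ### Finite decomposition into cells and passage to the limit -/

theorem frontier_disjointed_subset {X ι : Type*} [TopologicalSpace X] [Preorder ι]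
    [LocallyFiniteOrderBot ι] (f : ι → Set X) (i : ι) :
    frontier (disjointed f i) ⊆ ⋃ j, frontier (f j) := by
  refine disjointedRec (p := fun s => frontier s ⊆ ⋃ j, frontier (f j)) (fun {s j} hs => ?_)
    (subset_iUnion (fun j => frontier (f j)) i)
  rw [sdiff_eq]
  refine (frontier_inter_subset _ _).trans (union_subset (inter_subset_left.trans hs) ?_)
  rw [frontier_compl]
  exact inter_subset_right.trans (subset_iUnion (fun j => frontier (f j)) j)

/-- In a compact set, the points at small positive distance from `A` are near the boundary. -/
theorem exists_pos_level_inter_subset {X : Type*} [MetricSpace X] {A Q G : Set X}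
    (hQ : IsCompact Q) (hG : IsOpen G) (hQG : frontier A ∩ Q ⊆ G) :
    ∃ δ > 0, ∀ r, 0 < r → r < δ → {x | infEDist x A = ENNReal.ofReal r} ∩ Q ⊆ G := by
  -- `Q \ G` may meet `A`, but only in its interior, where no point has positive distance; the rest
  -- is compact and off `closure A`.
  have hcomp : IsCompact ((Q \ G) \ interior A) := (hQ.diff hG).diff isOpen_interior
  have hdisj : Disjoint ((Q \ G) \ interior A) (closure A) :=
    disjoint_left.2 fun x hx hxA => hx.1.2 (hQG ⟨⟨hxA, hx.2⟩, hx.1.1⟩)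
  obtain ⟨δ, hδ, hlt⟩ := exists_pos_forall_lt_edist hcomp isClosed_closure hdisj
  refine ⟨δ, by exact_mod_cast hδ, fun r hr hrδ x hx => ?_⟩
  by_contra hxG
  have hxA : x ∉ closure A := notMem_closure_of_infEDist_eq hr hx.1
  have hle : (δ : ℝ≥0∞) ≤ infEDist x (closure A) := le_infEDist.2 fun y hy =>
    (hlt x ⟨⟨hx.2, hxG⟩, fun hi => hxA (subset_closure (interior_subset hi))⟩ y hy).le
  rw [infEDist_closure, hx.1, ← ENNReal.ofReal_coe_nnreal,
    ENNReal.ofReal_le_ofReal_iff hr.le] at hle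
  linarith

/-- The limit superior estimate up to a factor `K > 1`. -/
theorem HasC1BoundaryIn.limsup_level_le_mul {A U Ω : Set (EuclideanSpace ℝ (Fin d))}
    (hA : HasC1BoundaryIn A U) (hd : 1 ≤ d) (hΩo : IsOpen Ω) (hΩb : Bornology.IsBounded Ω)
    (hΩU : closure Ω ⊆ U)
    (htrans : Measure.hausdorffMeasure ((d : ℝ) - 1) (frontier A ∩ frontier Ω) = 0)
    (M : Set (EuclideanSpace ℝ (Fin d))) {K : ℝ≥0} (hK : 1 < K) :
    limsup (fun r : ℝ => Measure.hausdorffMeasure ((d : ℝ) - 1)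
        (({x | infEDist x A = ENNReal.ofReal r} ∩ Ω) \
          {x | infEDist x M < ENNReal.ofReal (3 * r)})) (𝓝[>] 0)
      ≤ (K : ℝ≥0∞) ^ ((d : ℝ) - 1) *
        Measure.hausdorffMeasure ((d : ℝ) - 1) ((frontier A ∩ Ω) \ closure M) := by
  set H : Measure (EuclideanSpace ℝ (Fin d)) := Measure.hausdorffMeasure ((d : ℝ) - 1) with hH
  have hd' : (0 : ℝ) ≤ (d : ℝ) - 1 := by
    rw [sub_nonneg]
    exact_mod_cast hd
  have hKtop : (K : ℝ≥0∞) ^ ((d : ℝ) - 1) ≠ ∞ :=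
    (ENNReal.rpow_lt_top_of_nonneg hd' ENNReal.coe_ne_top).ne
  have hQ : IsCompact (closure Ω) := hΩb.isCompact_closure
  have hS : IsCompact (frontier A ∩ closure Ω) := hQ.inter_left isClosed_frontier
  -- charts around the points of the boundary, and balls whose spheres are null sets in it
  have hchart : ∀ p : ↥(frontier A ∩ closure Ω), ∃ ρ > 0, H (frontier A ∩ ball p.1 ρ) < ∞ ∧
      ∀ r, 0 < r → r < ρ / 8 → ∀ C ⊆ ball p.1 (ρ / 4),
        H (({x | infEDist x A = ENNReal.ofReal r} ∩ C) \
          {x | infEDist x M < ENNReal.ofReal (3 * r)}) ≤ (K : ℝ≥0∞) ^ ((d : ℝ) - 1) *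
        H (cthickening (2 * r) C ∩ ((frontier A ∩ ball p.1 ρ) \ closure M)) := fun p =>
    hA.exists_radius hd M hK ⟨p.2.1, hΩU p.2.2⟩
  choose ρ hρ hfin hlevel using hchart
  have hrad : ∀ p : ↥(frontier A ∩ closure Ω), ∃ s ∈ Ioo 0 (ρ p / 4),
      H (frontier A ∩ frontier (ball p.1 s)) = 0 := by
    intro p
    -- A finite measure charges only countably many concentric spheres.
    have : IsFiniteMeasure (H.restrict (frontier A ∩ ball p.1 (ρ p))) :=
      ⟨by rw [Measure.restrict_apply_univ]; exact hfin p⟩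
    obtain ⟨s, hs, hnull⟩ := exists_null_frontier_thickening
      (H.restrict (frontier A ∩ ball p.1 (ρ p))) {p.1} (show 0 < ρ p / 4 by linarith [hρ p])
    refine ⟨s, hs, ?_⟩
    rw [thickening_singleton, Measure.restrict_apply isClosed_frontier.measurableSet] at hnull
    refine measure_mono_null ?_ hnull
    intro x hx
    refine ⟨hx.2, hx.1, ?_⟩
    have := frontier_ball_subset_sphere hx.2
    rw [mem_sphere] at this
    rw [mem_ball]
    linarith [hs.2, hρ p]
  choose s hs hnull using hrad
  obtain ⟨t, ht⟩ := hS.elim_finite_subcover (fun p : ↥(frontier A ∩ closure Ω) => ball p.1 (s p))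
    (fun _ => isOpen_ball) fun x hx => mem_iUnion.2 ⟨⟨x, hx⟩, mem_ball_self (hs ⟨x, hx⟩).1⟩
  set c : Fin t.card → ↥(frontier A ∩ closure Ω) := fun i => (t.equivFin.symm i).1 with hc
  set B : Fin t.card → Set (EuclideanSpace ℝ (Fin d)) := fun i => ball (c i).1 (s (c i)) with hB
  have hcover : frontier A ∩ closure Ω ⊆ ⋃ i, B i := by
    intro x hx
    obtain ⟨p, hp, hxp⟩ := mem_iUnion₂.1 (ht hx)
    exact mem_iUnion.2 ⟨t.equivFin ⟨p, hp⟩, by simpa [hB, hc] using hxp⟩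
  set T : Fin t.card → Set (EuclideanSpace ℝ (Fin d)) := disjointed B with hT
  have hTm : ∀ i, MeasurableSet (T i) := fun i =>
    disjointedRec (p := fun s => MeasurableSet s) (fun {_ _} hs => hs.diff isOpen_ball.measurableSet)
      isOpen_ball.measurableSet
  have hTB : ∀ i, T i ⊆ ball (c i).1 (ρ (c i) / 4) := fun i =>
    (disjointed_subset B i).trans (ball_subset_ball (hs (c i)).2.le)
  set F : Fin t.card → Set (EuclideanSpace ℝ (Fin d)) := fun i =>
    (frontier A ∩ ball (c i).1 (ρ (c i))) \ closure M with hF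
  have hFm : ∀ i, MeasurableSet (F i) := fun i =>
    (isClosed_frontier.measurableSet.inter isOpen_ball.measurableSet).diff
      isClosed_closure.measurableSet
  obtain ⟨δ, hδ, hsub⟩ := exists_pos_level_inter_subset hQ (isOpen_iUnion fun i => isOpen_ball)
    hcover
  -- decomposition of the level set
  have hbound : ∀ᶠ r : ℝ in 𝓝[>] 0,
      H (({x | infEDist x A = ENNReal.ofReal r} ∩ Ω) \
          {x | infEDist x M < ENNReal.ofReal (3 * r)}) ≤
        ∑ i, (K : ℝ≥0∞) ^ ((d : ℝ) - 1) * H.restrict (F i) (cthickening (2 * r) (T i ∩ Ω)) := by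
    have hsmall : ∀ᶠ r : ℝ in 𝓝[>] 0, ∀ i, r < ρ (c i) / 8 := eventually_all.2 fun i =>
      nhdsWithin_le_nhds (gt_mem_nhds (by linarith [hρ (c i)]))
    filter_upwards [hsmall, self_mem_nhdsWithin, nhdsWithin_le_nhds (gt_mem_nhds hδ)]
      with r hr hr0 hrδ
    refine (measure_mono (t := ⋃ i, (({x | infEDist x A = ENNReal.ofReal r} ∩ (T i ∩ Ω)) \
          {x | infEDist x M < ENNReal.ofReal (3 * r)})) ?_).trans
        ((measure_iUnion_fintype_le _ _).trans (Finset.sum_le_sum fun i _ => ?_))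
    · rintro x ⟨⟨hxA, hxΩ⟩, hxM⟩
      have hx := hsub r hr0 hrδ ⟨hxA, subset_closure hxΩ⟩
      rw [← iUnion_disjointed] at hx
      obtain ⟨i, hi⟩ := mem_iUnion.1 hx
      exact mem_iUnion.2 ⟨i, ⟨hxA, hi, hxΩ⟩, hxM⟩
    · rw [Measure.restrict_apply isClosed_cthickening.measurableSet]
      exact hlevel (c i) r hr0 (hr i) _ (inter_subset_left.trans (hTB i))
  have hlim : Tendsto (fun r : ℝ => ∑ i, (K : ℝ≥0∞) ^ ((d : ℝ) - 1) *
      H.restrict (F i) (cthickening (2 * r) (T i ∩ Ω))) (𝓝[>] 0)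
      (𝓝 (∑ i, (K : ℝ≥0∞) ^ ((d : ℝ) - 1) * H.restrict (F i) (closure (T i ∩ Ω)))) := by
    refine tendsto_finsetSum _ fun i _ => ENNReal.Tendsto.const_mul ?_ (Or.inr hKtop)
    have hFfin : H (F i) < ∞ := (measure_mono sdiff_subset).trans_lt (hfin (c i))
    have h2 : Tendsto (fun r : ℝ => 2 * r) (𝓝[>] 0) (𝓝 0) := by
      have : Tendsto (fun r : ℝ => 2 * r) (𝓝 0) (𝓝 (2 * 0)) := Continuous.tendsto (by fun_prop) 0
      rw [mul_zero] at this
      exact this.mono_left nhdsWithin_le_nhds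
    -- Continuity from above, available because the restricted measure is finite.
    refine (tendsto_measure_cthickening ⟨1, one_pos, ?_⟩).comp h2
    refine ((measure_mono (subset_univ _)).trans_lt ?_).ne
    rwa [Measure.restrict_apply_univ]
  have hcell : ∀ i, H.restrict (F i) (closure (T i ∩ Ω)) ≤
      H (T i ∩ ((frontier A ∩ Ω) \ closure M)) := by
    intro i
    rw [Measure.restrict_apply isClosed_closure.measurableSet]
    have hN : H ((frontier A ∩ frontier Ω) ∪ ⋃ j, frontier A ∩ frontier (B j)) = 0 :=
      measure_union_null htrans (measure_iUnion_null fun j => hnull (c j))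
    refine (measure_mono (t := (T i ∩ ((frontier A ∩ Ω) \ closure M)) ∪
      ((frontier A ∩ frontier Ω) ∪ ⋃ j, frontier A ∩ frontier (B j))) ?_).trans
      ((measure_union_le _ _).trans (by rw [hN, add_zero]))
    -- A point of the closed cell outside the cell lies on `∂Ω` or on one of the spheres.
    rintro x ⟨hx, ⟨hxA, -⟩, hxM⟩
    by_cases hxi : x ∈ T i ∩ Ω
    · exact Or.inl ⟨hxi.1, ⟨hxA, hxi.2⟩, hxM⟩
    · right
      have hxf : x ∈ frontier (T i ∩ Ω) := ⟨hx, fun h => hxi (interior_subset h)⟩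
      rcases frontier_inter_subset _ _ hxf with h | h
      · obtain ⟨j, hj⟩ := mem_iUnion.1 (frontier_disjointed_subset B i h.1)
        exact Or.inr (mem_iUnion.2 ⟨j, hxA, hj⟩)
      · exact Or.inl ⟨hxA, h.2⟩
  calc limsup (fun r : ℝ => H (({x | infEDist x A = ENNReal.ofReal r} ∩ Ω) \
          {x | infEDist x M < ENNReal.ofReal (3 * r)})) (𝓝[>] 0)
      ≤ limsup (fun r : ℝ => ∑ i, (K : ℝ≥0∞) ^ ((d : ℝ) - 1) *
          H.restrict (F i) (cthickening (2 * r) (T i ∩ Ω))) (𝓝[>] 0) := limsup_le_limsup hbound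
    _ = ∑ i, (K : ℝ≥0∞) ^ ((d : ℝ) - 1) * H.restrict (F i) (closure (T i ∩ Ω)) := hlim.limsup_eq
    _ ≤ ∑ i, (K : ℝ≥0∞) ^ ((d : ℝ) - 1) * H (T i ∩ ((frontier A ∩ Ω) \ closure M)) := by
        exact Finset.sum_le_sum fun i _ => mul_le_mul_right (hcell i) _
    _ = (K : ℝ≥0∞) ^ ((d : ℝ) - 1) * H (⋃ i, T i ∩ ((frontier A ∩ Ω) \ closure M)) := by
        rw [← Finset.mul_sum, measure_iUnion, tsum_fintype]
        · exact fun i j hij => (disjoint_disjointed B hij).mono inter_subset_left inter_subset_left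
        · exact fun i => (hTm i).inter ((isClosed_frontier.measurableSet.inter
            hΩo.measurableSet).diff isClosed_closure.measurableSet)
    _ ≤ (K : ℝ≥0∞) ^ ((d : ℝ) - 1) * H ((frontier A ∩ Ω) \ closure M) := by
        gcongr
        exact iUnion_subset fun i => inter_subset_right

end Euclidean

theorem lemma6p2 {d : ℕ} (hd : 1 ≤ d)
    (Ω : Set (EuclideanSpace ℝ (Fin d))) (hΩo : IsOpen Ω) (hΩb : Bornology.IsBounded Ω)
    (A U : Set (EuclideanSpace ℝ (Fin d))) (hU : IsOpen U) (hΩU : closure Ω ⊆ U)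
    (hA : HasC1BoundaryIn A U)
    (htrans : MeasureTheory.Measure.hausdorffMeasure ((d : ℝ) - 1)
      (frontier A ∩ frontier Ω) = 0)
    (M : Set (EuclideanSpace ℝ (Fin d))) (hM : M ⊆ Ω) :
    Filter.limsup
      (fun r : ℝ => MeasureTheory.Measure.hausdorffMeasure ((d : ℝ) - 1)
        (({x | Metric.infEDist x A = ENNReal.ofReal r} ∩ Ω) \
          {x | Metric.infEDist x M < ENNReal.ofReal (3 * r)}))
      (nhdsWithin 0 (Set.Ioi 0))
    ≤ MeasureTheory.Measure.hausdorffMeasure ((d : ℝ) - 1) ((frontier A ∩ Ω) \ M) := by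
  -- `M` may be non-measurable; passing to `closure M` only strengthens the bound and makes
  -- additivity over cells available.
  refine le_trans ?_ (measure_mono (sdiff_subset_sdiff_right (subset_closure (s := M))))
  have hlim : Tendsto (fun K : ℝ≥0 => (K : ℝ≥0∞) ^ ((d : ℝ) - 1) *
      Measure.hausdorffMeasure ((d : ℝ) - 1) ((frontier A ∩ Ω) \ closure M)) (𝓝[>] 1)
      (𝓝 (1 * Measure.hausdorffMeasure ((d : ℝ) - 1) ((frontier A ∩ Ω) \ closure M))) := by
    refine ENNReal.Tendsto.mul_const ?_ (Or.inl one_ne_zero)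
    have : Tendsto (fun K : ℝ≥0 => (K : ℝ≥0∞) ^ ((d : ℝ) - 1)) (𝓝 1)
        (𝓝 (((1 : ℝ≥0) : ℝ≥0∞) ^ ((d : ℝ) - 1))) :=
      (ENNReal.continuous_rpow_const.comp ENNReal.continuous_coe).tendsto 1
    rw [ENNReal.coe_one, ENNReal.one_rpow] at this
    exact this.mono_left nhdsWithin_le_nhds
  rw [one_mul] at hlim
  refine ge_of_tendsto hlim ?_
  filter_upwards [self_mem_nhdsWithin] with K hK
  exact hA.limsup_level_le_mul hd hΩo hΩb hΩU htrans M hK
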